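/- A planted plane tree is a finite rooted tree, with at least one vertex, in which every vertex may have arbitrarily many children and the children of each vertex are linearly ordered from left to right; two such trees are identified if they are isomorphic as ordered rooted trees. Let $\mathcal T_n$ denote the (finite) set of planted plane trees with exactly $n$ vertices. View a planted plane tree $T$ as a poset in which $v\le w$ if and only if $v=w$ or $v$ is a descendant of $w$, so that the root is the maximal element. For planted plane trees $S$ and $T$, an embedding of $S$ into $T$ is a set $X$ of vertices of $T$ such that the subposet of $T$ induced on $X$ is isomorphic to $S$ by an isomorphism under which the left-to-right order of the children of each vertex of $S$ is the one inherited from $T$. An embedding is good if it contains the root of $T$. Write $S\subseteq T$ if there is at least one embedding of $S$ into $T$. Let $a_{T}(S)$ and $g_{T}(S)$ be the numbers of all embeddings and of good embeddings of $S$ into $T$, and put $$a_{\mathcal T_n}(S)=\sum_{T\in\mathcal T_n}a_T(S),\qquad g_{\mathcal T_n}(S)=\sum_{T\in\mathcal T_n}g_T(S).$$ Let $S_1,S_2$ be planted plane trees with $S_1\subseteq S_2$. Then for all sufficiently large $n$ the numbers $a_{\mathcal T_n}(S_1)$ and $a_{\mathcal T_n}(S_2)$ are positive and $$\frac{g_{\mathcal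 T_n}(S_1)}{a_{\mathcal T_n}(S_1)}\le\frac{g_{\mathcal T_n}(S_2)}{a_{\mathcal T_n}(S_2)}.$$ -/

import Mathlib

/-- Plane rooted trees (Catalan trees): a root together with the finite ordered list, read from left
to right, of the plane rooted trees attached to it. There is no empty tree. -/
inductive PlaneTree : Type where
  | node : List PlaneTree → PlaneTree

namespace PlaneTree

/-- `IsVertex p T` says that the address `p` leads to a vertex of `T`: the root has the address `[]`,
and if the `i`-th subtree attached to the root (counted from the left, starting at `0`) has a vertex
with address `q`, then this vertex has the address `i :: q` in the whole tree. -/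
def IsVertex : List ℕ → PlaneTree → Prop
  | [], _ => True
  | i :: p, node ts => ∃ t, ts[i]? = some t ∧ IsVertex p t

/-- The vertex set of a plane tree, each vertex being given by its address. -/
def vertices (T : PlaneTree) : Set (List ℕ) := {p | IsVertex p T}

/-- The size of a plane tree: its number of vertices. -/
noncomputable def size (T : PlaneTree) : ℕ := T.vertices.ncard

/-- The tree order on the addresses: `Below v w` says that `v` is `w` or a descendant of `w`.
The root is the maximal element. -/
def Below (v w : List ℕ) : Prop := w <+: v

/-- The left-to-right order on the addresses: `LeftOf v w` says that there is a vertex `p` such that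
`v` and `w` lie in the subtrees of two different children of `p`, the one for `v` being further to
the left. -/
def LeftOf (v w : List ℕ) : Prop :=
  ∃ (p : List ℕ) (i j : ℕ), i < j ∧ Below v (p ++ [i]) ∧ Below w (p ++ [j])

/-- A set `X` of vertices of `T` is a (plane) embedding of `S` into `T` if the subposet of `T`
induced on `X` is isomorphic to the poset `S` by an isomorphism under which the left-to-right order
of the children of each vertex of `S` is the one inherited from `T`. -/
def IsEmbedding (S T : PlaneTree) (X : Set (List ℕ)) : Prop :=
  X ⊆ T.vertices ∧
    ∃ f : S.vertices ≃ X,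
      (∀ u v : S.vertices, Below (u : List ℕ) v ↔ Below (f u : List ℕ) (f v)) ∧
      (∀ (p : List ℕ) (i j : ℕ) (hi : p ++ [i] ∈ S.vertices) (hj : p ++ [j] ∈ S.vertices),
        i < j → LeftOf (f ⟨p ++ [i], hi⟩ : List ℕ) (f ⟨p ++ [j], hj⟩))

/-- `S ⊆ T`: there is at least one embedding of `S` into `T`. -/
def EmbedsInto (S T : PlaneTree) : Prop := ∃ X, IsEmbedding S T X

/-- The number `a_T(S)` of all embeddings of `S` into `T`. -/
noncomputable def allCount (T S : PlaneTree) : ℕ := {X | IsEmbedding S T X}.ncard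

/-- The number `g_T(S)` of good embeddings of `S` into `T`: those that contain the root of `T`. -/
noncomputable def goodCount (T S : PlaneTree) : ℕ := {X | IsEmbedding S T X ∧ [] ∈ X}.ncard

theorem cons_mem_vertices {ts : List PlaneTree} {i : ℕ} {p : List ℕ} :
    i :: p ∈ (node ts).vertices ↔ ∃ t, ts[i]? = some t ∧ p ∈ t.vertices := Iff.rfl

theorem nil_mem_vertices (T : PlaneTree) : [] ∈ T.vertices := by
  cases T; trivial

theorem finite_vertices : (T : PlaneTree) → T.vertices.Finite
  | node ts => by
    have ih : ∀ t ∈ ts, t.vertices.Finite := fun t _ => finite_vertices t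
    have hfin : (⋃ i : Fin ts.length, (List.cons i.1) '' (ts[i.1]).vertices).Finite :=
      Set.finite_iUnion fun i => (ih _ (List.getElem_mem i.2)).image _
    refine (hfin.insert []).subset ?_
    rintro (_ | ⟨i, p⟩) hp
    · exact Set.mem_insert _ _
    · obtain ⟨t, ht, hpt⟩ := cons_mem_vertices.1 hp
      obtain ⟨hi, rfl⟩ := List.getElem?_eq_some_iff.1 ht
      exact Set.mem_insert_of_mem _ (Set.mem_iUnion.2 ⟨⟨i, hi⟩, p, hpt, rfl⟩)
termination_by T => sizeOf T
decreasing_by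
  have := List.sizeOf_lt_of_mem ‹_ ∈ ts›
  simp only [node.sizeOf_spec]
  omega

/-- The sets of embeddings that are counted by `allCount` and `goodCount` are finite. -/
theorem finite_embeddings (S T : PlaneTree) : {X | IsEmbedding S T X}.Finite :=
  (finite_vertices T).finite_subsets.subset fun _ hX => hX.1

theorem size_lt_of_mem {ts : List PlaneTree} {t : PlaneTree} (ht : t ∈ ts) :
    t.size < (node ts).size := by
  obtain ⟨i, hi⟩ := List.mem_iff_getElem?.1 ht
  have h1 : (List.cons i '' t.vertices).ncard = t.size :=
    Set.ncard_image_of_injective _ (List.cons_injective)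
  rw [← h1]
  refine Set.ncard_lt_ncard ⟨?_, fun h => ?_⟩ (finite_vertices _)
  · rintro _ ⟨p, hp, rfl⟩
    exact cons_mem_vertices.2 ⟨t, hi, hp⟩
  · obtain ⟨p, -, hp⟩ := h (nil_mem_vertices (node ts))
    exact List.cons_ne_nil _ _ hp

theorem length_lt_size (ts : List PlaneTree) : ts.length < (node ts).size := by
  have h1 : ((fun i : ℕ => [i]) '' (Set.Iio ts.length)).ncard = ts.length := by
    rw [Set.ncard_image_of_injective _ (fun a b h => by simpa using h)]
    simp [Set.ncard_eq_toFinset_card']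
  conv_lhs => rw [← h1]
  refine Set.ncard_lt_ncard ⟨?_, fun h => ?_⟩ (finite_vertices _)
  · rintro _ ⟨i, hi, rfl⟩
    exact cons_mem_vertices.2 ⟨_, List.getElem?_eq_getElem hi, nil_mem_vertices _⟩
  · obtain ⟨p, -, hp⟩ := h (nil_mem_vertices (node ts))
    exact List.cons_ne_nil _ _ hp

theorem finite_size_lt (n : ℕ) : {T : PlaneTree | T.size < n}.Finite := by
  induction n with
  | zero => simp
  | succ n ih =>
    have : Finite {T : PlaneTree | T.size < n} := ih
    have h := (((List.finite_length_lt {T : PlaneTree | T.size < n} n).image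
      (List.map Subtype.val)).image node)
    refine h.subset ?_
    rintro ⟨ts⟩ hT
    have hT' : (node ts).size < n + 1 := hT
    have hmem : ∀ t ∈ ts, t.size < n := fun t ht => by
      have := size_lt_of_mem ht
      omega
    have hlen := length_lt_size ts
    refine ⟨ts, ⟨ts.attach.map fun t => ⟨t.1, hmem t.1 t.2⟩, ?_, ?_⟩, rfl⟩
    · have : (ts.attach.map fun t => (⟨t.1, hmem t.1 t.2⟩ : {T : PlaneTree | T.size < n})).length
          < n := by
        rw [List.length_map, List.length_attach]
        omega
      exact this
    · simp [List.map_map, Function.comp_def]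

theorem finite_size_eq (n : ℕ) : {T : PlaneTree | T.size = n}.Finite :=
  (finite_size_lt (n + 1)).subset fun T (hT : T.size = n) => 
    (Nat.lt_succ_of_le hT.le : T.size < n + 1)

/-- The family `𝒯ₙ` of all planted plane trees of size `n`. -/
noncomputable def plantedTrees (n : ℕ) : Finset PlaneTree := (finite_size_eq n).toFinset

/-- The cumulative number `∑ a_T(S)` over all `T ∈ 𝒯ₙ` of all embeddings of `S`. -/
noncomputable def allTotal (n : ℕ) (S : PlaneTree) : ℕ := ∑ T ∈ plantedTrees n, allCount T S

/-- The cumulative number `∑ g_T(S)` over all `T ∈ 𝒯ₙ` of good embeddings of `S`. -/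
noncomputable def goodTotal (n : ℕ) (S : PlaneTree) : ℕ := ∑ T ∈ plantedTrees n, goodCount T S

end PlaneTree

/-!
Let `X` be a set of vertices of `T`. The descendant order and the left-to-right order make `X` a
plane forest, which is computed by recursion on `T`, and the embeddings of `S` into `T` are the sets
`X` whose forest is `[S]`. Splitting off the leftmost branch at the root of `T` then yields
convolution recurrences for the numbers of copies of forests, hence equations for their generating
functions. These functions are Laurent polynomials in `w = √(1 - 4X)`: the one of the good
embeddings of `S` has a pole at `w = 0` whose order `k` is the number of vertices plus the number of
leaves of `S`, minus `2`, and the one of all embeddings has order `k + 1` and half the leading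
coefficient. Comparing coefficients, `√n` times the ratio of the good to all embeddings tends to
`2 Γ((k + 1) / 2) / Γ(k / 2)`. This limit is strictly increasing in `k`, and `k` strictly increases
along embeddings between different trees.
-/

section CoefficientAsymptotics

open PowerSeries Filter Topology

/-- The power series `(1 - a * X) ^ s`, for an arbitrary real exponent `s`. -/
noncomputable def oneSubRpow (a s : ℝ) : ℝ⟦X⟧ := rescale (-a) (binomialSeries ℝ s)

theorem oneSubRpow_zero (a : ℝ) : oneSubRpow a 0 = 1 := by
  rw [oneSubRpow, binomialSeries_zero, map_one]

theorem oneSubRpow_one (a : ℝ) : oneSubRpow a 1 = 1 - C a * X := by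
  rw [oneSubRpow, ← Nat.cast_one, binomialSeries_nat, pow_one, map_add, map_one, rescale_X, map_neg]
  ring

theorem oneSubRpow_add (a s t : ℝ) :
    oneSubRpow a (s + t) = oneSubRpow a s * oneSubRpow a t := by
  rw [oneSubRpow, binomialSeries_add, map_mul, oneSubRpow, oneSubRpow]

theorem oneSubRpow_pow (a s : ℝ) (n : ℕ) : oneSubRpow a s ^ n = oneSubRpow a (n * s) := by
  induction n with
  | zero => rw [pow_zero, Nat.cast_zero, zero_mul, oneSubRpow_zero]
  | succ n ih => rw [pow_succ, ih, ← oneSubRpow_add, Nat.cast_succ, add_one_mul]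

theorem constantCoeff_oneSubRpow (a s : ℝ) : constantCoeff (oneSubRpow a s) = 1 := by
  rw [← coeff_zero_eq_constantCoeff_apply, oneSubRpow, coeff_rescale, pow_zero, one_mul,
    coeff_zero_eq_constantCoeff_apply, binomialSeries_constantCoeff]

theorem coeff_oneSubRpow_neg (a s : ℝ) (n : ℕ) :
    coeff n (oneSubRpow a (-s)) = a ^ n * ((ascPochhammer ℝ n).eval s / n.factorial) := by
  have hfactorial : (n.factorial : ℝ) * Ring.multichoose s n = (ascPochhammer ℝ n).eval s := by
    rw [← nsmul_eq_mul, Ring.factorial_nsmul_multichoose_eq_ascPochhammer,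
      Polynomial.ascPochhammer_smeval_eq_eval]
  have hchoose : Ring.choose (-s) n = (-1) ^ n * Ring.multichoose s n := by
    rw [Ring.choose_neg', ← Int.cast_negOnePow_natCast, Units.smul_def, zsmul_eq_mul]
  rw [oneSubRpow, coeff_rescale, binomialSeries_coeff, hchoose, ← hfactorial,
    mul_div_cancel_left₀ _ (Nat.cast_ne_zero.2 n.factorial_ne_zero), smul_eq_mul, mul_one,
    ← mul_assoc, ← mul_pow, mul_neg_one, neg_neg]

theorem ascPochhammer_eval_eq_prod_range (s : ℝ) (n : ℕ) :
    (ascPochhammer ℝ n).eval s = ∏ k ∈ Finset.range n, (s + k) := by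
  induction n with
  | zero => simp
  | succ n ih => rw [ascPochhammer_succ_eval, ih, Finset.prod_range_succ]

theorem ascPochhammer_eval_div_eq_inv_gammaSeq {s : ℝ} {n : ℕ} (hn : n ≠ 0) (hs : s + n ≠ 0) :
    (ascPochhammer ℝ n).eval s / n.factorial / (n : ℝ) ^ (s - 1) =
      (Real.GammaSeq s n)⁻¹ * (n / (n + s)) := by
  have hn' : (n : ℝ) ≠ 0 := Nat.cast_ne_zero.2 hn
  rw [Real.GammaSeq, Finset.prod_range_succ, ← ascPochhammer_eval_eq_prod_range,
    Real.rpow_sub_one hn', add_comm (n : ℝ) s]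
  field_simp

/-- If `s` is a nonpositive integer, then the series is a polynomial and its coefficients do tend to
the junk value `(Real.Gamma s)⁻¹ = 0⁻¹ = 0`. -/
theorem tendsto_coeff_oneSubRpow_neg_div {a : ℝ} (ha : a ≠ 0) (s : ℝ) :
    Tendsto (fun n : ℕ => coeff n (oneSubRpow a (-s)) / (a ^ n * (n : ℝ) ^ (s - 1))) atTop
      (𝓝 (Real.Gamma s)⁻¹) := by
  have hcoeff (n : ℕ) : coeff n (oneSubRpow a (-s)) / (a ^ n * (n : ℝ) ^ (s - 1)) =
      (ascPochhammer ℝ n).eval s / n.factorial / (n : ℝ) ^ (s - 1) := by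
    rw [coeff_oneSubRpow_neg, mul_div_mul_left _ _ (pow_ne_zero n ha)]
  simp only [hcoeff]
  by_cases hpole : Real.Gamma s = 0
  · obtain ⟨m, rfl⟩ := (Real.Gamma_eq_zero_iff s).1 hpole
    rw [hpole, inv_zero]
    refine tendsto_const_nhds.congr' ?_
    filter_upwards [eventually_gt_atTop m] with n hmn
    have hzero : (ascPochhammer ℝ n).eval (-m : ℝ) = 0 :=
      (ascPochhammer_eval_eq_zero_iff n _).2 ⟨m, hmn, (neg_neg _).symm⟩
    rw [hzero, zero_div, zero_div]
  · have hlim := ((Real.GammaSeq_tendsto_Gamma s).inv₀ hpole).mul (tendsto_natCast_div_add_atTop s)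
    rw [mul_one] at hlim
    refine hlim.congr' ?_
    filter_upwards [eventually_ne_atTop 0] with n hn
    exact (ascPochhammer_eval_div_eq_inv_gammaSeq hn
      fun h => hpole ((Real.Gamma_eq_zero_iff s).2 ⟨n, eq_neg_of_add_eq_zero_left h⟩)).symm

theorem tendsto_coeff_oneSubRpow_neg_div_of_lt {a : ℝ} (ha : a ≠ 0) {s t : ℝ} (hst : s < t) :
    Tendsto (fun n : ℕ => coeff n (oneSubRpow a (-s)) / (a ^ n * (n : ℝ) ^ (t - 1))) atTop
      (𝓝 0) := by
  have hpow : Tendsto (fun n : ℕ => (n : ℝ) ^ (-(t - s))) atTop (𝓝 0) :=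
    (tendsto_rpow_neg_atTop (sub_pos.2 hst)).comp tendsto_natCast_atTop_atTop
  have hlim := (tendsto_coeff_oneSubRpow_neg_div ha s).mul hpow
  rw [mul_zero] at hlim
  refine hlim.congr' ?_
  filter_upwards [eventually_gt_atTop 0] with n hn
  have hn' : (0 : ℝ) < n := Nat.cast_pos.2 hn
  rw [show t - 1 = (s - 1) + (t - s) by ring, Real.rpow_add hn', Real.rpow_neg hn'.le,
    ← div_eq_mul_inv, div_div, mul_assoc]

end CoefficientAsymptotics

section GammaRatio

open Real

theorem gamma_add_mul_gamma_le {δ s t : ℝ} (hδ : 0 < δ) (hs : 0 < s) (hst : s < t) :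
    Gamma (s + δ) * Gamma t ≤ Gamma s * Gamma (t + δ) := by
  have ht : 0 < t + δ := by linarith
  have hsum : 0 < t - s + δ := by linarith
  set a := (t - s) / (t - s + δ) with ha
  set b := δ / (t - s + δ) with hb
  have ha_pos : 0 < a := div_pos (sub_pos.2 hst) hsum
  have hb_pos : 0 < b := div_pos hδ hsum
  have hab : a + b = 1 := by rw [ha, hb, ← add_div, div_self hsum.ne']
  have hleft : a * s + b * (t + δ) = s + δ := by
    rw [ha, hb]
    field_simp
    ring
  have hright : b * s + a * (t + δ) = t := by
    linear_combination (s + t + δ) * hab - hleft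
  have hrpow {x : ℝ} (hx : 0 < x) : Gamma x ^ a * Gamma x ^ b = Gamma x := by
    rw [← rpow_add (Gamma_pos_of_pos hx), hab, rpow_one]
  calc Gamma (s + δ) * Gamma t
      ≤ (Gamma s ^ a * Gamma (t + δ) ^ b) * (Gamma s ^ b * Gamma (t + δ) ^ a) := by
        refine mul_le_mul ?_ ?_ (Gamma_nonneg_of_nonneg (hs.trans hst).le) (by positivity)
        · rw [← hleft]
          exact Gamma_mul_add_mul_le_rpow_Gamma_mul_rpow_Gamma hs ht ha_pos hb_pos hab
        · nth_rw 1 [← hright]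
          exact Gamma_mul_add_mul_le_rpow_Gamma_mul_rpow_Gamma hs ht hb_pos ha_pos
            ((add_comm b a).trans hab)
    _ = (Gamma s ^ a * Gamma s ^ b) * (Gamma (t + δ) ^ a * Gamma (t + δ) ^ b) := by ring
    _ = Gamma s * Gamma (t + δ) := by rw [hrpow hs, hrpow ht]

/-- At `s = 0` both sides vanish, by the convention `Real.Gamma 0 = 0`. -/
theorem gamma_add_div_gamma {δ s : ℝ} (hδ : 0 < δ) (hs : 0 ≤ s) :
    Gamma (s + δ) / Gamma s = s / (s + δ) * (Gamma (s + 1 + δ) / Gamma (s + 1)) := by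
  rcases hs.eq_or_lt with rfl | hs
  · rw [Gamma_zero, div_zero, zero_div, zero_mul]
  · have hΓ := (Gamma_pos_of_pos hs).ne'
    rw [add_right_comm, Gamma_add_one (by positivity), Gamma_add_one hs.ne']
    field_simp

/-- Log-convexity gives weak monotonicity, and the functional equation makes it strict. -/
theorem strictMonoOn_gamma_add_div_gamma {δ : ℝ} (hδ : 0 < δ) :
    StrictMonoOn (fun s => Gamma (s + δ) / Gamma s) (Set.Ici 0) := by
  intro s (hs : 0 ≤ s) t _ hst
  have ht : 0 < t := hs.trans_lt hst
  have hratio : 0 < Gamma (t + 1 + δ) / Gamma (t + 1) :=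
    div_pos (Gamma_pos_of_pos (by positivity)) (Gamma_pos_of_pos (by positivity))
  calc Gamma (s + δ) / Gamma s
      = s / (s + δ) * (Gamma (s + 1 + δ) / Gamma (s + 1)) := gamma_add_div_gamma hδ hs
    _ ≤ s / (s + δ) * (Gamma (t + 1 + δ) / Gamma (t + 1)) := by
        refine mul_le_mul_of_nonneg_left ?_ (by positivity)
        rw [div_le_div_iff₀ (Gamma_pos_of_pos (by positivity)) (Gamma_pos_of_pos (by positivity)),
          mul_comm (Gamma (t + 1 + δ))]
        exact gamma_add_mul_gamma_le hδ (by positivity) (by linarith)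
    _ < t / (t + δ) * (Gamma (t + 1 + δ) / Gamma (t + 1)) := by
        refine mul_lt_mul_of_pos_right ?_ hratio
        rw [div_lt_div_iff₀ (by positivity) (by positivity)]
        nlinarith
    _ = Gamma (t + δ) / Gamma t := (gamma_add_div_gamma hδ ht.le).symm

end GammaRatio

namespace PlaneTree

section Addresses

theorem below_nil (v : List ℕ) : Below v [] := List.nil_prefix

theorem not_below_nil_cons (i : ℕ) (w : List ℕ) : ¬ Below [] (i :: w) := by
  simp [Below]

theorem below_cons {i j : ℕ} {v w : List ℕ} : Below (i :: v) (j :: w) ↔ i = j ∧ Below v w := by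
  simp [Below, List.cons_prefix_cons, eq_comm]

theorem below_refl (v : List ℕ) : Below v v := List.prefix_rfl

theorem Below.trans {u v w : List ℕ} (h : Below u v) (h' : Below v w) : Below u w :=
  List.IsPrefix.trans h' h

theorem Below.antisymm {u v : List ℕ} (h : Below u v) (h' : Below v u) : u = v :=
  List.IsPrefix.eq_of_length h'
    (le_antisymm (List.IsPrefix.length_le h') (List.IsPrefix.length_le h))

theorem not_leftOf_nil_left (w : List ℕ) : ¬ LeftOf [] w := by
  rintro ⟨p, i, j, -, h, -⟩
  simp [Below] at h

theorem not_leftOf_nil_right (v : List ℕ) : ¬ LeftOf v [] := by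
  rintro ⟨p, i, j, -, -, h⟩
  simp [Below] at h

theorem leftOf_cons {i j : ℕ} {v w : List ℕ} :
    LeftOf (i :: v) (j :: w) ↔ i < j ∨ i = j ∧ LeftOf v w := by
  constructor
  · rintro ⟨_ | ⟨a, p⟩, k, l, hkl, h1, h2⟩
    · simp only [List.nil_append, below_cons] at h1 h2
      omega
    · simp only [List.cons_append, below_cons] at h1 h2
      exact Or.inr ⟨h1.1.trans h2.1.symm, p, k, l, hkl, h1.2, h2.2⟩
  · rintro (h | ⟨rfl, p, k, l, hkl, h1, h2⟩)
    · exact ⟨[], i, j, h, below_cons.2 ⟨rfl, below_nil _⟩, below_cons.2 ⟨rfl, below_nil _⟩⟩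
    · exact ⟨i :: p, k, l, hkl, below_cons.2 ⟨rfl, h1⟩, below_cons.2 ⟨rfl, h2⟩⟩

theorem LeftOf.mono {u v u' v' : List ℕ} (h : LeftOf u v) (hu : Below u' u) (hv : Below v' v) :
    LeftOf u' v' := by
  obtain ⟨p, i, j, hij, h1, h2⟩ := h
  exact ⟨p, i, j, hij, hu.trans h1, hv.trans h2⟩

theorem leftOf_irrefl : ∀ v : List ℕ, ¬ LeftOf v v
  | [] => not_leftOf_nil_left _
  | i :: v => by simp [leftOf_cons, leftOf_irrefl v]

theorem LeftOf.not_below {u v : List ℕ} (h : LeftOf u v) : ¬ Below u v := fun h' =>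
  leftOf_irrefl u (h.mono (below_refl u) h')

theorem LeftOf.not_above {u v : List ℕ} (h : LeftOf u v) : ¬ Below v u := fun h' =>
  leftOf_irrefl v (h.mono h' (below_refl v))

theorem LeftOf.asymm : ∀ {u v : List ℕ}, LeftOf u v → ¬ LeftOf v u
  | [], _, h => absurd h (not_leftOf_nil_left _)
  | _, [], h => absurd h (not_leftOf_nil_right _)
  | i :: u, j :: v, h => by
    have ih : LeftOf u v → ¬ LeftOf v u := LeftOf.asymm
    rw [leftOf_cons] at h ⊢
    grind

theorem below_or_above_or_leftOf : ∀ u v : List ℕ,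
    Below u v ∨ Below v u ∨ LeftOf u v ∨ LeftOf v u
  | [], v => Or.inr (Or.inl (below_nil v))
  | u, [] => Or.inl (below_nil u)
  | i :: u, j :: v => by
    have ih := below_or_above_or_leftOf u v
    simp only [below_cons, leftOf_cons]
    grind

theorem mem_vertices_of_below : ∀ {S : PlaneTree} {u w : List ℕ}, Below u w → u ∈ S.vertices →
    w ∈ S.vertices
  | S, _, [], _, _ => nil_mem_vertices S
  | _, [], i :: w, h, _ => absurd h (not_below_nil_cons i w)
  | node ss, j :: u, i :: w, h, hu => by
    obtain ⟨rfl, hw⟩ := below_cons.1 h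
    obtain ⟨t, ht, hu⟩ := cons_mem_vertices.1 hu
    exact cons_mem_vertices.2 ⟨t, ht, mem_vertices_of_below hw hu⟩

/-- The pairs `(u, v)` and `(u', v')` have the same relative position in the tree order and in the
left-to-right order. -/
def SamePosition (u v u' v' : List ℕ) : Prop :=
  (Below u' v' ↔ Below u v) ∧ (LeftOf u' v' ↔ LeftOf u v)

theorem LeftOf.samePosition {u v u' v' : List ℕ} (h : LeftOf u v) (h' : LeftOf u' v') :
    SamePosition u v u' v' :=
  ⟨iff_of_false h'.not_below h.not_below, iff_of_true h' h⟩

theorem LeftOf.samePosition_swap {u v u' v' : List ℕ} (h : LeftOf u v) (h' : LeftOf u' v') :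
    SamePosition v u v' u' :=
  ⟨iff_of_false h'.not_above h.not_above, iff_of_false h'.asymm h.asymm⟩

theorem samePosition_nil_right (u u' : List ℕ) : SamePosition u [] u' [] :=
  ⟨iff_of_true (below_nil u') (below_nil u),
    iff_of_false (not_leftOf_nil_right u') (not_leftOf_nil_right u)⟩

theorem samePosition_nil_left {v v' : List ℕ} (hv : v ≠ []) (hv' : v' ≠ []) :
    SamePosition [] v [] v' := by
  obtain ⟨i, p, rfl⟩ := List.exists_cons_of_ne_nil hv
  obtain ⟨j, q, rfl⟩ := List.exists_cons_of_ne_nil hv'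
  exact ⟨iff_of_false (not_below_nil_cons j q) (not_below_nil_cons i p),
    iff_of_false (not_leftOf_nil_left _) (not_leftOf_nil_left _)⟩

theorem samePosition_cons (i : ℕ) (u v : List ℕ) : SamePosition u v (i :: u) (i :: v) := by
  simp [SamePosition, below_cons, leftOf_cons]

/-- The injection of addresses that makes room for `n` new branches to the left of those at the
root. -/
def shift (n : ℕ) : List ℕ → List ℕ
  | [] => []
  | i :: p => (i + n) :: p

theorem samePosition_shift (n : ℕ) (u v : List ℕ) : SamePosition u v (shift n u) (shift n v) := by
  cases u <;> cases v <;> simp [SamePosition, shift, below_cons, leftOf_cons, below_nil,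
    not_below_nil_cons, not_leftOf_nil_left, not_leftOf_nil_right]

theorem shift_injective (n : ℕ) : Function.Injective (shift n) := fun u v h =>
  ((samePosition_shift n u v).1.1 (h ▸ below_refl _)).antisymm
    ((samePosition_shift n v u).1.1 (h ▸ below_refl _))

theorem shift_eq_nil_iff {n : ℕ} {u : List ℕ} : shift n u = [] ↔ u = [] := by
  cases u <;> simp [shift]

theorem zero_cons_ne_shift (u v : List ℕ) : 0 :: u ≠ shift 1 v := by
  cases v <;> simp [shift]

end Addresses

section ForestVertices

/-- The vertices of a plane forest: those of the tree with this list of branches, without the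
root. -/
def forestVertices (L : List PlaneTree) : Set (List ℕ) := (node L).vertices \ {[]}

theorem cons_mem_forestVertices {L : List PlaneTree} {i : ℕ} {p : List ℕ} :
    i :: p ∈ forestVertices L ↔ ∃ t, L[i]? = some t ∧ p ∈ t.vertices := by
  simp [forestVertices, cons_mem_vertices]

theorem nil_notMem_forestVertices (L : List PlaneTree) : [] ∉ forestVertices L := fun h => h.2 rfl

theorem vertices_node (L : List PlaneTree) : (node L).vertices = insert [] (forestVertices L) := by
  rw [forestVertices, Set.insert_sdiff_singleton, Set.insert_eq_of_mem (nil_mem_vertices _)]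

theorem finite_forestVertices (L : List PlaneTree) : (forestVertices L).Finite :=
  (finite_vertices _).subset Set.sdiff_subset

theorem forestVertices_nil : forestVertices [] = ∅ := by
  ext u
  cases u <;> simp [nil_notMem_forestVertices, cons_mem_forestVertices]

theorem forestVertices_singleton (T : PlaneTree) :
    forestVertices [T] = List.cons 0 '' T.vertices := by
  ext u
  rcases u with _ | ⟨_ | i, u⟩ <;> simp [nil_notMem_forestVertices, cons_mem_forestVertices]

theorem forestVertices_append (L M : List PlaneTree) :
    forestVertices (L ++ M) = forestVertices L ∪ shift L.length '' forestVertices M := by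
  ext u
  rcases u with _ | ⟨i, u⟩
  · simp [nil_notMem_forestVertices, shift_eq_nil_iff]
  have hshift : i :: u ∈ shift L.length '' forestVertices M ↔
      L.length ≤ i ∧ (i - L.length) :: u ∈ forestVertices M := by
    constructor
    · rintro ⟨_ | ⟨j, q⟩, hq, h⟩
      · exact absurd hq (nil_notMem_forestVertices M)
      · obtain ⟨rfl, rfl⟩ := List.cons.inj h
        simpa using hq
    · rintro ⟨hi, h⟩
      exact ⟨_, h, by simp [shift, hi]⟩
  rw [Set.mem_union, hshift]
  simp only [cons_mem_forestVertices]
  rcases lt_or_ge i L.length with hi | hi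
  · simp [List.getElem?_append_left hi, hi.not_ge]
  · simp [List.getElem?_append_right hi, hi]

theorem forestVertices_cons (T : PlaneTree) (L : List PlaneTree) :
    forestVertices (T :: L) = List.cons 0 '' T.vertices ∪ shift 1 '' forestVertices L := by
  rw [← List.singleton_append, forestVertices_append, forestVertices_singleton,
    List.length_singleton]

theorem leftOf_shift_length {L M : List PlaneTree} {u v : List ℕ} (hu : u ∈ forestVertices L)
    (hv : v ∈ forestVertices M) : LeftOf u (shift L.length v) := by
  rcases u with _ | ⟨i, u⟩
  · exact absurd hu (nil_notMem_forestVertices L)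
  rcases v with _ | ⟨j, v⟩
  · exact absurd hv (nil_notMem_forestVertices M)
  obtain ⟨t, ht, -⟩ := cons_mem_forestVertices.1 hu
  have hi : i < L.length := (List.getElem?_eq_some_iff.1 ht).1
  exact leftOf_cons.2 (Or.inl (by omega))

theorem leftOf_zero_cons_shift {v : List ℕ} (u : List ℕ) (hv : v ≠ []) :
    LeftOf (0 :: u) (shift 1 v) := by
  obtain ⟨i, p, rfl⟩ := List.exists_cons_of_ne_nil hv
  exact leftOf_cons.2 (Or.inl i.succ_pos)

end ForestVertices

section PlaneEquiv

/-- Two sets of addresses are isomorphic for the tree order and the left-to-right order. The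
isomorphism is a map of all addresses of which only the values on `U` matter; it need not be
required to be injective, as the tree order is antisymmetric. -/
def PlaneEquiv (U V : Set (List ℕ)) : Prop :=
  ∃ f : List ℕ → List ℕ, f '' U = V ∧ ∀ u ∈ U, ∀ v ∈ U, SamePosition u v (f u) (f v)

variable {U V W U' V' : Set (List ℕ)}

theorem injOn_of_samePosition {f : List ℕ → List ℕ}
    (hf : ∀ u ∈ U, ∀ v ∈ U, SamePosition u v (f u) (f v)) : Set.InjOn f U := fun u hu v hv h =>
  ((hf u hu v hv).1.1 (h ▸ below_refl _)).antisymm ((hf v hv u hu).1.1 (h ▸ below_refl _))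

theorem PlaneEquiv.of_image {f : List ℕ → List ℕ} (hf : ∀ u v, SamePosition u v (f u) (f v))
    (U : Set (List ℕ)) : PlaneEquiv U (f '' U) :=
  ⟨f, rfl, fun u _ v _ => hf u v⟩

theorem PlaneEquiv.symm (h : PlaneEquiv U V) : PlaneEquiv V U := by
  obtain ⟨f, rfl, hf⟩ := h
  have hinv : Set.LeftInvOn (Function.invFunOn f U) f U :=
    (injOn_of_samePosition hf).leftInvOn_invFunOn
  refine ⟨Function.invFunOn f U, hinv.image_image, ?_⟩
  rintro _ ⟨u, hu, rfl⟩ _ ⟨v, hv, rfl⟩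
  rw [hinv hu, hinv hv]
  exact ⟨(hf u hu v hv).1.symm, (hf u hu v hv).2.symm⟩

theorem PlaneEquiv.trans (h : PlaneEquiv U V) (h' : PlaneEquiv V W) : PlaneEquiv U W := by
  obtain ⟨f, rfl, hf⟩ := h
  obtain ⟨g, rfl, hg⟩ := h'
  refine ⟨g ∘ f, Set.image_comp g f U, fun u hu v hv => ?_⟩
  have hgf := hg (f u) ⟨u, hu, rfl⟩ (f v) ⟨v, hv, rfl⟩
  exact ⟨hgf.1.trans (hf u hu v hv).1, hgf.2.trans (hf u hu v hv).2⟩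

theorem PlaneEquiv.union (hdisj : Disjoint U V)
    (hpos : ∀ u ∈ U, ∀ v ∈ V, ∀ u' ∈ U', ∀ v' ∈ V',
      SamePosition u v u' v' ∧ SamePosition v u v' u')
    (hU : PlaneEquiv U U') (hV : PlaneEquiv V V') : PlaneEquiv (U ∪ V) (U' ∪ V') := by
  classical
  obtain ⟨f, rfl, hf⟩ := hU
  obtain ⟨g, rfl, hg⟩ := hV
  have hfU : Set.EqOn (U.piecewise f g) f U := U.piecewise_eqOn f g
  have hgV : Set.EqOn (U.piecewise f g) g V := fun v hv =>
    Set.piecewise_eq_of_notMem _ _ _ (Set.disjoint_right.1 hdisj hv)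
  refine ⟨U.piecewise f g, by rw [Set.image_union, hfU.image_eq, hgV.image_eq], ?_⟩
  rintro u (hu | hu) v (hv | hv)
  · rw [hfU hu, hfU hv]
    exact hf u hu v hv
  · rw [hfU hu, hgV hv]
    exact (hpos u hu v hv _ ⟨u, hu, rfl⟩ _ ⟨v, hv, rfl⟩).1
  · rw [hgV hu, hfU hv]
    exact (hpos v hv u hu _ ⟨v, hv, rfl⟩ _ ⟨u, hu, rfl⟩).2
  · rw [hgV hu, hgV hv]
    exact hg u hu v hv

theorem PlaneEquiv.union_of_leftOf (h : ∀ u ∈ U, ∀ v ∈ V, LeftOf u v)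
    (h' : ∀ u ∈ U', ∀ v ∈ V', LeftOf u v) (hU : PlaneEquiv U U') (hV : PlaneEquiv V V') :
    PlaneEquiv (U ∪ V) (U' ∪ V') :=
  PlaneEquiv.union
    (Set.disjoint_left.2 fun u hu hv => leftOf_irrefl u (h u hu u hv))
    (fun u hu v hv u' hu' v' hv' =>
      ⟨(h u hu v hv).samePosition (h' u' hu' v' hv'),
        (h u hu v hv).samePosition_swap (h' u' hu' v' hv')⟩)
    hU hV

theorem PlaneEquiv.insert_nil (hU : [] ∉ U) (hV : [] ∉ V) (h : PlaneEquiv U V) :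
    PlaneEquiv (insert [] U) (insert [] V) := by
  have hroot : PlaneEquiv {[]} {[]} := ⟨id, Set.image_id _, fun _ _ _ _ => ⟨Iff.rfl, Iff.rfl⟩⟩
  refine PlaneEquiv.union (Set.disjoint_singleton_left.2 hU) ?_ hroot h
  rintro _ rfl v hv _ rfl v' hv'
  exact ⟨samePosition_nil_left (ne_of_mem_of_not_mem hv hU) (ne_of_mem_of_not_mem hv' hV),
    samePosition_nil_right v v'⟩

theorem PlaneEquiv.append {L M : List PlaneTree} (h : ∀ u ∈ U, ∀ v ∈ V, LeftOf u v)
    (hU : PlaneEquiv (forestVertices L) U) (hV : PlaneEquiv (forestVertices M) V) :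
    PlaneEquiv (forestVertices (L ++ M)) (U ∪ V) := by
  rw [forestVertices_append]
  refine PlaneEquiv.union_of_leftOf ?_ h hU
    ((PlaneEquiv.of_image (samePosition_shift L.length) _).symm.trans hV)
  rintro u hu _ ⟨v, hv, rfl⟩
  exact leftOf_shift_length hu hv

theorem planeEquiv_forestVertices_singleton (S : PlaneTree) :
    PlaneEquiv S.vertices (forestVertices [S]) := by
  rw [forestVertices_singleton]
  exact PlaneEquiv.of_image (samePosition_cons 0) _

end PlaneEquiv

section PlaneEquivUnique

theorem forest_induction {P : List PlaneTree → Prop} (nil : P [])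
    (cons : ∀ ts M, P ts → P M → P (node ts :: M)) : ∀ M, P M
  | [] => nil
  | node ts :: M => cons ts M (forest_induction nil cons ts) (forest_induction nil cons M)

theorem PlaneEquiv.restrict {U : Set (List ℕ)} {f : List ℕ → List ℕ}
    (hf : ∀ u ∈ U, ∀ v ∈ U, SamePosition u v (f u) (f v)) {p q : List ℕ → Prop}
    (hpq : ∀ u ∈ U, p u ↔ q (f u)) : PlaneEquiv {u ∈ U | p u} {v ∈ f '' U | q v} := by
  refine ⟨f, ?_, fun u hu v hv => hf u hu.1 v hv.1⟩
  ext v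
  constructor
  · rintro ⟨u, ⟨hu, hpu⟩, rfl⟩
    exact ⟨⟨u, hu, rfl⟩, (hpq u hu).1 hpu⟩
  · rintro ⟨⟨u, hu, rfl⟩, hqu⟩
    exact ⟨u, ⟨hu, (hpq u hu).2 hqu⟩, rfl⟩

variable (ss L : List PlaneTree)

theorem zero_mem_forestVertices_cons (S : PlaneTree) : [0] ∈ forestVertices (S :: L) :=
  cons_mem_forestVertices.2 ⟨S, rfl, nil_mem_vertices S⟩

theorem below_zero_or_leftOf {u : List ℕ} (hu : u ≠ []) : Below u [0] ∨ LeftOf [0] u := by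
  obtain ⟨i, p, rfl⟩ := List.exists_cons_of_ne_nil hu
  rcases i.eq_zero_or_pos with rfl | hi
  · exact Or.inl (below_cons.2 ⟨rfl, below_nil p⟩)
  · exact Or.inr (leftOf_cons.2 (Or.inl hi))

theorem eq_zero_of_below_or_leftOf {r : List ℕ} (hr : r ≠ [])
    (h : Below [0] r ∨ LeftOf r [0]) : r = [0] := by
  obtain ⟨i, p, rfl⟩ := List.exists_cons_of_ne_nil hr
  cases p with
  | nil => simp_all [below_cons, leftOf_cons, not_leftOf_nil_right]
  | cons j p => simp [below_cons, leftOf_cons, not_leftOf_nil_right, not_below_nil_cons] at h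

theorem planeEquiv_strictly_below_zero :
    PlaneEquiv (forestVertices ss)
      {u ∈ forestVertices (node ss :: L) | Below u [0] ∧ ¬ Below [0] u} := by
  convert PlaneEquiv.of_image (samePosition_cons 0) (forestVertices ss) using 1
  ext u
  rcases u with _ | ⟨_ | i, _ | ⟨j, u⟩⟩ <;>
    simp [forestVertices, cons_mem_vertices, below_cons, below_nil, not_below_nil_cons]

theorem planeEquiv_right_of_zero :
    PlaneEquiv (forestVertices L) {u ∈ forestVertices (node ss :: L) | LeftOf [0] u} := by
  convert PlaneEquiv.of_image (samePosition_shift 1) (forestVertices L) using 1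
  ext u
  rw [forestVertices_cons]
  constructor
  · rintro ⟨⟨v, -, rfl⟩ | hu, h⟩
    · simp [leftOf_cons, not_leftOf_nil_left] at h
    · exact hu
  · rintro ⟨v, hv, rfl⟩
    exact ⟨Or.inr ⟨v, hv, rfl⟩, leftOf_zero_cons_shift [] hv.2⟩

/-- The isomorphism fixes `[0]`, the only vertex `r` such that every vertex lies below `r` or to the
right of it; hence it maps what lies below `[0]`, and what lies to its right, onto their
counterparts. -/
theorem eq_of_planeEquiv_forestVertices (L : List PlaneTree) :
    ∀ L', PlaneEquiv (forestVertices L) (forestVertices L') → L = L' := by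
  induction L using forest_induction with
  | nil =>
    rintro (_ | ⟨S, L'⟩) ⟨f, hf, -⟩
    · rfl
    · rw [forestVertices_nil, Set.image_empty] at hf
      exact absurd (hf ▸ zero_mem_forestVertices_cons L' S) (Set.notMem_empty _)
  | cons ss L ihss ihL =>
    rintro (_ | ⟨⟨ss'⟩, L'⟩) ⟨f, hfV, hf⟩
    · rw [forestVertices_nil, Set.image_eq_empty] at hfV
      exact absurd (hfV ▸ zero_mem_forestVertices_cons L (node ss)) (Set.notMem_empty _)
    have h0 := zero_mem_forestVertices_cons L (node ss)
    have hf0 : f [0] = [0] := by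
      obtain ⟨u, hu, hu0⟩ : [0] ∈ f '' forestVertices (node ss :: L) :=
        hfV ▸ zero_mem_forestVertices_cons L' (node ss')
      have hf0V : f [0] ∈ forestVertices (node ss' :: L') := hfV ▸ Set.mem_image_of_mem f h0
      have hhead := below_zero_or_leftOf hu.2
      rw [← (hf u hu _ h0).1, ← (hf _ h0 u hu).2, hu0] at hhead
      exact eq_zero_of_below_or_leftOf hf0V.2 hhead
    have hbelow := PlaneEquiv.restrict hf (p := fun u => Below u [0] ∧ ¬ Below [0] u)
      (q := fun u => Below u [0] ∧ ¬ Below [0] u) fun u hu => by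
        conv_rhs => rw [← hf0, (hf u hu _ h0).1, (hf _ h0 u hu).1]
    have hright := PlaneEquiv.restrict hf (p := LeftOf [0]) (q := LeftOf [0]) fun u hu => by
      conv_rhs => rw [← hf0, (hf _ h0 u hu).2]
    rw [hfV] at hbelow hright
    have hss : ss = ss' := ihss ss' (((planeEquiv_strictly_below_zero ss L).trans hbelow).trans
      (planeEquiv_strictly_below_zero ss' L').symm)
    have hL : L = L' := ihL L' (((planeEquiv_right_of_zero ss L).trans hright).trans
      (planeEquiv_right_of_zero ss' L').symm)
    rw [hss, hL]

end PlaneEquivUnique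

section Induced

open Classical in
mutual

/-- The plane forest that the tree order and the left-to-right order induce on a set `X` of vertices
of a tree. -/
noncomputable def induced : PlaneTree → Set (List ℕ) → List PlaneTree
  | node ts, X => if [] ∈ X then [node (inducedForest ts X)] else inducedForest ts X

/-- The plane forest induced on a set of vertices of a forest, see `induced`. -/
noncomputable def inducedForest : List PlaneTree → Set (List ℕ) → List PlaneTree
  | [], _ => []
  | T :: M, X => induced T (List.cons 0 ⁻¹' X) ++ inducedForest M (shift 1 ⁻¹' X)

end

theorem inducedForest_insert_nil (M : List PlaneTree) (X : Set (List ℕ)) :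
    inducedForest M (insert [] X) = inducedForest M X := by
  induction M generalizing X with
  | nil => rw [inducedForest, inducedForest]
  | cons T M ih =>
    have h0 : List.cons 0 ⁻¹' insert [] X = List.cons 0 ⁻¹' X := by ext; simp
    have h1 : shift 1 ⁻¹' insert [] X = insert [] (shift 1 ⁻¹' X) := by
      ext; simp [shift_eq_nil_iff]
    rw [inducedForest, inducedForest, h0, h1, ih]

variable {ts M : List PlaneTree} {X : Set (List ℕ)}

theorem planeEquiv_induced_node
    (h : PlaneEquiv (forestVertices (inducedForest ts X)) (forestVertices ts ∩ X)) :
    PlaneEquiv (forestVertices (induced (node ts) X)) ((node ts).vertices ∩ X) := by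
  rw [vertices_node, induced]
  split_ifs with hX
  · rw [Set.insert_inter_of_mem hX]
    refine (planeEquiv_forestVertices_singleton _).symm.trans ?_
    rw [vertices_node]
    exact h.insert_nil (nil_notMem_forestVertices _) fun h0 => nil_notMem_forestVertices _ h0.1
  · rwa [Set.insert_inter_of_notMem hX]

theorem planeEquiv_inducedForest (M : List PlaneTree) (X : Set (List ℕ)) :
    PlaneEquiv (forestVertices (inducedForest M X)) (forestVertices M ∩ X) := by
  induction M using forest_induction generalizing X with
  | nil =>
    rw [inducedForest, forestVertices_nil, Set.empty_inter]
    exact ⟨id, Set.image_empty _, fun u hu => absurd hu (Set.notMem_empty u)⟩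
  | cons ts M ihts ihM =>
    rw [inducedForest, forestVertices_cons, Set.union_inter_distrib_right,
      ← Set.image_inter_preimage, ← Set.image_inter_preimage]
    refine PlaneEquiv.append ?_
      ((planeEquiv_induced_node (ihts _)).trans (PlaneEquiv.of_image (samePosition_cons 0) _))
      ((ihM _).trans (PlaneEquiv.of_image (samePosition_shift 1) _))
    rintro _ ⟨u, -, rfl⟩ _ ⟨v, hv, rfl⟩
    exact leftOf_zero_cons_shift u hv.1.2

theorem planeEquiv_induced (T : PlaneTree) (X : Set (List ℕ)) :
    PlaneEquiv (forestVertices (induced T X)) (T.vertices ∩ X) := by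
  obtain ⟨ts⟩ := T
  exact planeEquiv_induced_node (planeEquiv_inducedForest ts X)

end Induced

section Embeddings

variable {S T : PlaneTree} {X : Set (List ℕ)}

theorem IsEmbedding.planeEquiv (h : IsEmbedding S T X) : PlaneEquiv S.vertices X := by
  obtain ⟨-, f, hbelow, hchildren⟩ := h
  have hleft (u v : S.vertices) (h : LeftOf (u : List ℕ) v) : LeftOf (f u : List ℕ) (f v) := by
    obtain ⟨p, i, j, hij, hi, hj⟩ := h
    have hi' := mem_vertices_of_below hi u.2
    have hj' := mem_vertices_of_below hj v.2
    exact (hchildren p i j hi' hj' hij).mono ((hbelow u ⟨_, hi'⟩).1 hi) ((hbelow v ⟨_, hj'⟩).1 hj)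
  let g : List ℕ → List ℕ := Function.extend Subtype.val (fun u => (f u : List ℕ)) id
  have hg (u : S.vertices) : g u = f u := Subtype.val_injective.extend_apply _ _ u
  refine ⟨g, ?_, fun u hu v hv => ?_⟩
  · ext x
    refine ⟨?_, fun hx => ⟨f.symm ⟨x, hx⟩, Subtype.coe_prop _, by simp [hg]⟩⟩
    rintro ⟨u, hu, rfl⟩
    exact hg ⟨u, hu⟩ ▸ Subtype.coe_prop _
  · lift u to S.vertices using hu
    lift v to S.vertices using hv
    rw [hg, hg]
    refine ⟨(hbelow u v).symm, fun h => ?_, hleft u v⟩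
    rcases below_or_above_or_leftOf (u : List ℕ) v with h' | h' | h' | h'
    · exact absurd ((hbelow u v).1 h') h.not_below
    · exact absurd ((hbelow v u).1 h') h.not_above
    · exact h'
    · exact absurd h (hleft v u h').asymm

theorem PlaneEquiv.isEmbedding (h : PlaneEquiv S.vertices X) (hX : X ⊆ T.vertices) :
    IsEmbedding S T X := by
  obtain ⟨f, rfl, hf⟩ := h
  exact ⟨hX, Equiv.Set.imageOfInjOn f S.vertices (injOn_of_samePosition hf),
    fun u v => (hf u u.2 v v.2).1.symm, fun p i j hi hj hij =>
      (hf _ hi _ hj).2.2 ⟨p, i, j, hij, below_refl _, below_refl _⟩⟩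

theorem isEmbedding_iff : IsEmbedding S T X ↔ X ⊆ T.vertices ∧ induced T X = [S] := by
  constructor
  · refine fun h => ⟨h.1, eq_of_planeEquiv_forestVertices _ _ ?_⟩
    have hT := planeEquiv_induced T X
    rw [Set.inter_eq_self_of_subset_right h.1] at hT
    exact (hT.trans h.planeEquiv.symm).trans (planeEquiv_forestVertices_singleton S)
  · rintro ⟨hX, h⟩
    have hT := planeEquiv_induced T X
    rw [Set.inter_eq_self_of_subset_right hX, h] at hT
    exact ((planeEquiv_forestVertices_singleton S).trans hT).isEmbedding hX

end Embeddings

section Counts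

/-- The number of copies of the forest `L` in the tree `T`. -/
noncomputable def treeCount (L : List PlaneTree) (T : PlaneTree) : ℕ :=
  {X | X ⊆ T.vertices ∧ induced T X = L}.ncard

/-- The number of copies of the forest `L` in the forest `M`. -/
noncomputable def forestCount (L M : List PlaneTree) : ℕ :=
  {X | X ⊆ forestVertices M ∧ inducedForest M X = L}.ncard

theorem allCount_eq_treeCount (T S : PlaneTree) : allCount T S = treeCount [S] T := by
  simp only [allCount, treeCount, isEmbedding_iff]

variable {L M ss : List PlaneTree} {T : PlaneTree}

theorem goodCount_node :
    goodCount (node M) (node ss) = forestCount ss M := by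
  have hset : {X | IsEmbedding (node ss) (node M) X ∧ [] ∈ X} =
      insert [] '' {X | X ⊆ forestVertices M ∧ inducedForest M X = ss} := by
    ext X
    simp only [isEmbedding_iff, induced, vertices_node, Set.mem_ofPred_eq, Set.mem_image]
    constructor
    · rintro ⟨⟨hX, hind⟩, h0⟩
      have hins : insert [] (X \ {[]}) = X := Set.insert_sdiff_self_of_mem h0
      refine ⟨X \ {[]}, ⟨Set.sdiff_singleton_subset_iff.2 hX, ?_⟩, hins⟩
      rw [← inducedForest_insert_nil, hins]
      simpa [h0] using hind
    · rintro ⟨Y, ⟨hY, rfl⟩, rfl⟩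
      simp [Set.insert_subset_insert hY, inducedForest_insert_nil]
  rw [goodCount, hset, forestCount]
  have hnil : ∀ X ∈ {X | X ⊆ forestVertices M ∧ inducedForest M X = ss}, [] ∉ X :=
    fun X hX h0 => nil_notMem_forestVertices M (hX.1 h0)
  refine Set.InjOn.ncard_image fun X hX Y hY h => ?_
  rw [← Set.insert_sdiff_self_of_notMem (hnil X hX), h,
    Set.insert_sdiff_self_of_notMem (hnil Y hY)]

theorem treeCount_node :
    treeCount L (node M) = forestCount L M +
      {X | (X ⊆ (node M).vertices ∧ induced (node M) X = L) ∧ [] ∈ X}.ncard := by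
  have hset : {X | X ⊆ (node M).vertices ∧ induced (node M) X = L} =
      {X | X ⊆ forestVertices M ∧ inducedForest M X = L} ∪
        {X | (X ⊆ (node M).vertices ∧ induced (node M) X = L) ∧ [] ∈ X} := by
    ext X
    have hsub : X ⊆ forestVertices M ↔ X ⊆ (node M).vertices ∧ [] ∉ X := by
      rw [forestVertices, Set.subset_sdiff, Set.disjoint_singleton_right]
    simp only [Set.mem_ofPred_eq, Set.mem_union, hsub, induced]
    by_cases h0 : [] ∈ X <;> simp [h0]
  rw [treeCount, hset, Set.ncard_union_eq ?_
    ((finite_forestVertices M).finite_subsets.subset fun X hX => hX.1)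
    ((finite_vertices (node M)).finite_subsets.subset fun X hX => hX.1.1), forestCount]
  exact Set.disjoint_left.2 fun X hX hX' => nil_notMem_forestVertices M (hX.1 hX'.2)

theorem treeCount_of_length_ne_one (hL : L.length ≠ 1) :
    treeCount L (node M) = forestCount L M := by
  rw [treeCount_node, Nat.add_eq_left]
  convert Set.ncard_empty (Set (List ℕ))
  refine Set.eq_empty_of_forall_notMem fun X hX => hL ?_
  rw [← hX.1.2, induced, if_pos hX.2, List.length_singleton]

theorem treeCount_singleton :
    treeCount [node ss] (node M) = forestCount [node ss] M + forestCount ss M := by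
  have hgood : goodCount (node M) (node ss) =
      {X | (X ⊆ (node M).vertices ∧ induced (node M) X = [node ss]) ∧ [] ∈ X}.ncard := by
    simp only [goodCount, isEmbedding_iff]
  rw [treeCount_node, ← hgood, goodCount_node]

theorem forestCount_nil_right (L : List PlaneTree) :
    forestCount L [] = if L = [] then 1 else 0 := by
  rw [forestCount, forestVertices_nil]
  simp only [Set.subset_empty_iff, inducedForest, eq_comm (b := L)]
  split_ifs with h <;> simp [h]

/-- The set of vertices of the forest `T :: M` that consists of a set of vertices of `T` and a set
of vertices of `M`. -/
def joinVertices (P : Set (List ℕ) × Set (List ℕ)) : Set (List ℕ) :=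
  List.cons 0 '' P.1 ∪ shift 1 '' P.2

theorem preimage_zero_cons_joinVertices (P : Set (List ℕ) × Set (List ℕ)) :
    List.cons 0 ⁻¹' joinVertices P = P.1 := by
  have hshift : List.cons 0 ⁻¹' (shift 1 '' P.2) = ∅ :=
    Set.eq_empty_of_forall_notMem fun u ⟨v, _, h⟩ => zero_cons_ne_shift u v h.symm
  rw [joinVertices, Set.preimage_union, hshift, Set.union_empty,
    Set.preimage_image_eq _ List.cons_injective]

theorem preimage_shift_joinVertices (P : Set (List ℕ) × Set (List ℕ)) :
    shift 1 ⁻¹' joinVertices P = P.2 := by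
  have hcons : shift 1 ⁻¹' (List.cons 0 '' P.1) = ∅ :=
    Set.eq_empty_of_forall_notMem fun u ⟨v, _, h⟩ => zero_cons_ne_shift v u h
  rw [joinVertices, Set.preimage_union, hcons, Set.empty_union,
    Set.preimage_image_eq _ (shift_injective 1)]

theorem joinVertices_injective : Function.Injective joinVertices := fun P Q h =>
  Prod.ext (by rw [← preimage_zero_cons_joinVertices, h, preimage_zero_cons_joinVertices])
    (by rw [← preimage_shift_joinVertices, h, preimage_shift_joinVertices])

theorem subsets_forestVertices_cons (T : PlaneTree) (M : List PlaneTree) :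
    {X | X ⊆ forestVertices (T :: M)} =
      joinVertices '' {P | P.1 ⊆ T.vertices ∧ P.2 ⊆ forestVertices M} := by
  ext X
  simp only [forestVertices_cons, Set.mem_ofPred_eq, Set.mem_image]
  constructor
  · intro hX
    obtain ⟨Y, hY, hYX⟩ := Set.subset_image_iff.1
      (Set.inter_subset_right : X ∩ List.cons 0 '' T.vertices ⊆ _)
    obtain ⟨Z, hZ, hZX⟩ := Set.subset_image_iff.1
      (Set.inter_subset_right : X ∩ shift 1 '' forestVertices M ⊆ _)
    refine ⟨(Y, Z), ⟨hY, hZ⟩, ?_⟩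
    rw [joinVertices, hYX, hZX, ← Set.inter_union_distrib_left, Set.inter_eq_left.2 hX]
  · rintro ⟨P, hP, rfl⟩
    exact Set.union_subset_union (Set.image_mono hP.1) (Set.image_mono hP.2)

theorem inducedForest_cons_joinVertices_eq_iff (P : Set (List ℕ) × Set (List ℕ)) :
    inducedForest (T :: M) (joinVertices P) = L ↔ ∃ k < L.length + 1,
      induced T P.1 = L.take k ∧ inducedForest M P.2 = L.drop k := by
  rw [inducedForest, preimage_zero_cons_joinVertices, preimage_shift_joinVertices]
  constructor
  · rintro rfl
    exact ⟨(induced T P.1).length, by simp, by simp, by simp⟩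
  · rintro ⟨k, -, hT, hM⟩
    rw [hT, hM, List.take_append_drop]

theorem forestCount_cons (L : List PlaneTree) (T : PlaneTree) (M : List PlaneTree) :
    forestCount L (T :: M) = ∑ k ∈ Finset.range (L.length + 1),
      treeCount (L.take k) T * forestCount (L.drop k) M := by
  let A (k : ℕ) : Set (Set (List ℕ)) := {X | X ⊆ T.vertices ∧ induced T X = L.take k}
  let B (k : ℕ) : Set (Set (List ℕ)) :=
    {X | X ⊆ forestVertices M ∧ inducedForest M X = L.drop k}
  have hset : {X | X ⊆ forestVertices (T :: M) ∧ inducedForest (T :: M) X = L} =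
      joinVertices '' ⋃ k ∈ (Finset.range (L.length + 1) : Set ℕ), A k ×ˢ B k := by
    rw [Set.ofPred_and, subsets_forestVertices_cons, ← Set.image_inter_preimage]
    congr 1
    ext P
    simp only [Set.mem_inter_iff, Set.mem_preimage, Set.mem_ofPred_eq, Set.mem_iUnion,
      inducedForest_cons_joinVertices_eq_iff, Finset.coe_range, Set.mem_Iio, Set.mem_prod, A, B]
    grind
  have hfin (k : ℕ) : (A k ×ˢ B k).Finite :=
    ((finite_vertices T).finite_subsets.subset fun X hX => hX.1).prod
      ((finite_forestVertices M).finite_subsets.subset fun X hX => hX.1)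
  have hdisj : (Finset.range (L.length + 1) : Set ℕ).PairwiseDisjoint fun k => A k ×ˢ B k := by
    intro k hk l hl hkl
    refine Set.disjoint_left.2 fun P hP hP' => hkl ?_
    have hlen := congrArg List.length (hP.1.2.symm.trans hP'.1.2)
    simp only [List.length_take, Finset.coe_range, Set.mem_Iio] at hlen hk hl
    omega
  rw [forestCount, hset, Set.ncard_image_of_injective _ joinVertices_injective,
    Set.Finite.ncard_biUnion (Finset.finite_toSet _) (fun k _ => hfin k) hdisj,
    finsum_mem_coe_finset]
  exact Finset.sum_congr rfl fun k _ => Set.ncard_prod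

end Counts

section Weight

mutual

/-- The number of vertices plus the number of leaves of a tree, minus `2`: with `w = √(1 - 4X)`, the
generating function of the good embeddings of `S` is `w ^ (-singOrder S)` times a polynomial in `w`.
The truncated subtraction concerns the one-vertex tree only, whose order is `0`. -/
def singOrder : PlaneTree → ℕ
  | node ss => forestWeight ss - 1

/-- The number of vertices plus the number of leaves of a plane forest. -/
def forestWeight : List PlaneTree → ℕ
  | [] => 0
  | T :: M => singOrder T + 2 + forestWeight M

end

theorem forestWeight_append (L M : List PlaneTree) :
    forestWeight (L ++ M) = forestWeight L + forestWeight M := by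
  induction L with
  | nil => rw [List.nil_append, forestWeight, Nat.zero_add]
  | cons T L ih => rw [List.cons_append, forestWeight, forestWeight, ih, ← Nat.add_assoc]

theorem forestWeight_singleton (T : PlaneTree) : forestWeight [T] = singOrder T + 2 := by
  rw [forestWeight, forestWeight, Nat.add_zero]

theorem forestWeight_ne_one : ∀ L : List PlaneTree, forestWeight L ≠ 1
  | [] => by simp [forestWeight]
  | T :: M => by
    rw [forestWeight]
    omega

theorem two_le_forestWeight {L : List PlaneTree} (hL : L ≠ []) : 2 ≤ forestWeight L := by
  obtain ⟨T, M, rfl⟩ := List.exists_cons_of_ne_nil hL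
  rw [forestWeight]
  omega

theorem forestWeight_induced_node {ts : List PlaneTree} {X : Set (List ℕ)}
    (hle : forestWeight (inducedForest ts X) ≤ forestWeight ts)
    (heq : forestWeight (inducedForest ts X) = forestWeight ts → inducedForest ts X = ts) :
    forestWeight (induced (node ts) X) ≤ forestWeight [node ts] ∧
      (forestWeight (induced (node ts) X) = forestWeight [node ts] →
        induced (node ts) X = [node ts]) := by
  have hts := forestWeight_ne_one ts
  have hind := forestWeight_ne_one (inducedForest ts X)
  rw [induced, forestWeight_singleton, singOrder]
  split_ifs
  · rw [forestWeight_singleton, singOrder]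
    exact ⟨by omega, fun h => by rw [heq (by omega)]⟩
  · exact ⟨by omega, fun h => by omega⟩

theorem forestWeight_inducedForest (M : List PlaneTree) (X : Set (List ℕ)) :
    forestWeight (inducedForest M X) ≤ forestWeight M ∧
      (forestWeight (inducedForest M X) = forestWeight M → inducedForest M X = M) := by
  induction M using forest_induction generalizing X with
  | nil => simp [inducedForest]
  | cons ts M ihts ihM =>
    obtain ⟨hle, heq⟩ := forestWeight_induced_node (ihts (List.cons 0 ⁻¹' X)).1 (ihts _).2
    obtain ⟨hle', heq'⟩ := ihM (shift 1 ⁻¹' X)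
    rw [inducedForest, ← List.singleton_append, forestWeight_append, forestWeight_append]
    exact ⟨by omega, fun h => by rw [heq (by omega), heq' (by omega)]⟩

theorem EmbedsInto.singOrder_lt {S T : PlaneTree} (h : EmbedsInto S T) (hne : S ≠ T) :
    singOrder S < singOrder T := by
  obtain ⟨ts⟩ := T
  obtain ⟨X, hX⟩ := h
  obtain ⟨hle, heq⟩ := forestWeight_inducedForest ts X
  obtain ⟨hle, heq⟩ := forestWeight_induced_node hle heq
  rw [(isEmbedding_iff.1 hX).2] at hle heq
  have hne' : forestWeight [S] ≠ forestWeight [node ts] := fun h =>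
    hne (List.singleton_inj.1 (heq h))
  simp only [forestWeight_singleton] at hle hne'
  omega

end Weight

section GeneratingFunctions

open PowerSeries

theorem size_node_nil : size (node []) = 1 := by
  rw [size, vertices_node, forestVertices_nil]
  simp

theorem size_node_cons (T : PlaneTree) (M : List PlaneTree) :
    size (node (T :: M)) = size T + size (node M) := by
  have hvert : (node (T :: M)).vertices =
      List.cons 0 '' T.vertices ∪ shift 1 '' (node M).vertices := by
    rw [vertices_node, vertices_node M, forestVertices_cons, Set.image_insert_eq,
      Set.union_insert]
    rfl
  have hdisj : Disjoint (List.cons 0 '' T.vertices) (shift 1 '' (node M).vertices) := by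
    rw [Set.disjoint_left]
    rintro _ ⟨u, -, rfl⟩ ⟨v, -, h⟩
    exact zero_cons_ne_shift u v h.symm
  rw [size, hvert, Set.ncard_union_eq hdisj ((finite_vertices T).image _)
    ((finite_vertices (node M)).image _), Set.ncard_image_of_injective _ List.cons_injective,
    Set.ncard_image_of_injective _ (shift_injective 1)]
  rfl

theorem size_pos (T : PlaneTree) : 0 < T.size :=
  (Set.ncard_pos (finite_vertices T)).2 ⟨[], nil_mem_vertices T⟩

/-- The list of the branches at the root. -/
def branches : PlaneTree → List PlaneTree
  | node M => M

/-- The tree obtained from `U` by attaching `T` to the root as a new leftmost branch. Every tree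
with more than one vertex arises in exactly one way, which is the recursive decomposition behind all
the generating functions below. -/
def graft (T U : PlaneTree) : PlaneTree := node (T :: U.branches)

theorem size_graft (T U : PlaneTree) : (graft T U).size = T.size + U.size := by
  obtain ⟨M⟩ := U
  exact size_node_cons T M

theorem graft_injective : Function.Injective fun P : PlaneTree × PlaneTree => graft P.1 P.2 := by
  rintro ⟨T, ⟨M⟩⟩ ⟨T', ⟨M'⟩⟩ h
  simpa [graft, branches] using h

theorem mem_plantedTrees {n : ℕ} {T : PlaneTree} : T ∈ plantedTrees n ↔ T.size = n := by
  simp [plantedTrees]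

theorem plantedTrees_zero : plantedTrees 0 = ∅ :=
  Finset.eq_empty_of_forall_notMem fun T hT => (size_pos T).ne' (mem_plantedTrees.1 hT)

open Classical in
theorem plantedTrees_erase_node_nil (n : ℕ) : (plantedTrees n).erase (node []) =
    (Finset.HasAntidiagonal.antidiagonal n).biUnion fun p =>
      (plantedTrees p.1 ×ˢ plantedTrees p.2).image fun P => graft P.1 P.2 := by
  ext T
  simp only [Finset.mem_erase, Finset.mem_biUnion, Finset.mem_image, Finset.mem_product,
    Finset.HasAntidiagonal.mem_antidiagonal, mem_plantedTrees]
  constructor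
  · obtain ⟨_ | ⟨T, M⟩⟩ := T
    · exact fun h => absurd rfl h.1
    · rintro ⟨-, hT⟩
      exact ⟨(T.size, (node M).size), hT ▸ (size_node_cons T M).symm, (T, node M), ⟨rfl, rfl⟩, rfl⟩
  · rintro ⟨p, hp, ⟨T, U⟩, ⟨hT, hU⟩, rfl⟩
    exact ⟨by simp [graft], by rw [size_graft, hT, hU, hp]⟩

theorem sum_plantedTrees {R : Type*} [AddCommMonoid R] (f : PlaneTree → R) (n : ℕ) :
    ∑ T ∈ plantedTrees n, f T = (if n = 1 then f (node []) else 0) +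
      ∑ p ∈ Finset.HasAntidiagonal.antidiagonal n, ∑ T ∈ plantedTrees p.1, ∑ U ∈ plantedTrees p.2,
        f (graft T U) := by
  classical
  have herase : ∑ T ∈ (plantedTrees n).erase (node []), f T =
      ∑ p ∈ Finset.HasAntidiagonal.antidiagonal n, ∑ T ∈ plantedTrees p.1, ∑ U ∈ plantedTrees p.2,
        f (graft T U) := by
    rw [plantedTrees_erase_node_nil, Finset.sum_biUnion]
    · refine Finset.sum_congr rfl fun p _ => ?_
      rw [Finset.sum_image graft_injective.injOn, Finset.sum_product]
    · intro p _ q _ hpq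
      simp only [Function.onFun, Finset.disjoint_left, Finset.mem_image, Finset.mem_product,
        mem_plantedTrees]
      rintro _ ⟨P, ⟨hP₁, hP₂⟩, rfl⟩ ⟨Q, ⟨hQ₁, hQ₂⟩, hQP⟩
      obtain rfl := graft_injective hQP
      exact hpq (Prod.ext (hP₁.symm.trans hQ₁) (hP₂.symm.trans hQ₂))
  rw [← herase]
  split_ifs with h
  · exact (Finset.add_sum_erase _ f (mem_plantedTrees.2 (size_node_nil.trans h.symm))).symm
  · rw [zero_add, Finset.erase_eq_of_notMem]
    exact fun hT => h ((mem_plantedTrees.1 hT).symm.trans size_node_nil)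

/-- The generating function of a statistic `f` on plane trees, which are counted by their size. -/
noncomputable def genSeries (f : PlaneTree → ℝ) : ℝ⟦X⟧ :=
  PowerSeries.mk fun n => ∑ T ∈ plantedTrees n, f T

theorem genSeries_add (f g : PlaneTree → ℝ) :
    genSeries (fun T => f T + g T) = genSeries f + genSeries g := by
  ext n
  simp only [genSeries, coeff_mk, map_add, Finset.sum_add_distrib]

theorem genSeries_eq_of_graft {ι : Type*} (s : Finset ι) (f : PlaneTree → ℝ)
    (g h : ι → PlaneTree → ℝ) (hf : ∀ T U, f (graft T U) = ∑ k ∈ s, g k T * h k U) :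
    genSeries f = C (f (node [])) * X + ∑ k ∈ s, genSeries (g k) * genSeries (h k) := by
  ext n
  have hcoeff (k : ι) : coeff n (genSeries (g k) * genSeries (h k)) =
      ∑ p ∈ Finset.HasAntidiagonal.antidiagonal n, ∑ T ∈ plantedTrees p.1, ∑ U ∈ plantedTrees p.2,
        g k T * h k U := by
    simp only [coeff_mul, genSeries, coeff_mk, Finset.sum_mul_sum]
  rw [map_add, map_sum, coeff_C_mul, coeff_X, mul_ite, mul_one, mul_zero, genSeries, coeff_mk,
    sum_plantedTrees]
  congr 1
  simp only [hcoeff, hf]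
  rw [Finset.sum_comm]
  exact Finset.sum_congr rfl fun p _ =>
    (Finset.sum_congr rfl fun T _ => Finset.sum_comm).trans Finset.sum_comm

/-- The generating function of the copies of the forest `L` in plane trees. -/
noncomputable def treeSeries (L : List PlaneTree) : ℝ⟦X⟧ :=
  genSeries fun T => treeCount L T

/-- The generating function of the copies of the forest `L` in plane trees that avoid the root. -/
noncomputable def forestSeries (L : List PlaneTree) : ℝ⟦X⟧ :=
  genSeries fun T => forestCount L T.branches

theorem coeff_forestSeries_branches (S : PlaneTree) (n : ℕ) :
    coeff n (forestSeries S.branches) = goodTotal n S := by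
  obtain ⟨ss⟩ := S
  rw [forestSeries, genSeries, coeff_mk, goodTotal, Nat.cast_sum]
  refine Finset.sum_congr rfl ?_
  rintro ⟨M⟩ -
  rw [goodCount_node]
  rfl

theorem coeff_treeSeries_singleton (S : PlaneTree) (n : ℕ) :
    coeff n (treeSeries [S]) = allTotal n S := by
  rw [treeSeries, genSeries, coeff_mk, allTotal, Nat.cast_sum]
  exact Finset.sum_congr rfl fun T _ => by rw [allCount_eq_treeCount]

variable {L : List PlaneTree}

theorem treeSeries_of_length_ne_one (hL : L.length ≠ 1) : treeSeries L = forestSeries L := by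
  unfold treeSeries forestSeries
  congr 1
  ext ⟨M⟩
  rw [treeCount_of_length_ne_one hL]
  rfl

theorem treeSeries_singleton (S : PlaneTree) :
    treeSeries [S] = forestSeries [S] + forestSeries S.branches := by
  unfold treeSeries forestSeries
  rw [← genSeries_add]
  congr 1
  ext ⟨M⟩
  obtain ⟨ss⟩ := S
  rw [treeCount_singleton, Nat.cast_add]
  rfl

theorem forestSeries_eq (L : List PlaneTree) :
    forestSeries L = (if L = [] then X else 0) + ∑ k ∈ Finset.range (L.length + 1),
      treeSeries (L.take k) * forestSeries (L.drop k) := by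
  conv_lhs => rw [forestSeries, genSeries_eq_of_graft (Finset.range (L.length + 1)) _
    (fun k T => treeCount (L.take k) T) (fun k U => forestCount (L.drop k) U.branches)
    fun T U => by rw [graft, branches, forestCount_cons]; push_cast; rfl]
  congr 1
  rw [branches, forestCount_nil_right]
  split_ifs <;> simp

/-- The power series `√(1 - 4X)`, see `sqrtSeries_mul_self`, in terms of the generating function
`forestSeries []` of plane trees. -/
noncomputable def sqrtSeries : ℝ⟦X⟧ := 1 - 2 * forestSeries []

theorem sqrtSeries_mul_self : sqrtSeries * sqrtSeries = 1 - 4 * X := by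
  have hcatalan : forestSeries [] = X + forestSeries [] * forestSeries [] := by
    conv_lhs => rw [forestSeries_eq]
    simp [treeSeries_of_length_ne_one]
  rw [sqrtSeries]
  linear_combination (-4) * hcatalan

theorem constantCoeff_sqrtSeries : constantCoeff sqrtSeries = 1 := by
  have hcatalan : constantCoeff (forestSeries []) = 0 := by
    rw [← coeff_zero_eq_constantCoeff_apply, forestSeries, genSeries, coeff_mk, plantedTrees_zero,
      Finset.sum_empty]
  simp [sqrtSeries, hcatalan]

theorem sqrtSeries_mul_inv : sqrtSeries * sqrtSeries⁻¹ = 1 :=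
  PowerSeries.mul_inv_cancel _ (by simp [constantCoeff_sqrtSeries])

theorem treeSeries_take_cons (S : PlaneTree) {k : ℕ} (hk : k ≤ L.length + 1) :
    treeSeries ((S :: L).take k) =
      forestSeries ((S :: L).take k) + if k = 1 then forestSeries S.branches else 0 := by
  split_ifs with hk1
  · rw [hk1, List.take_succ_cons, List.take_zero, treeSeries_singleton]
  · rw [add_zero, treeSeries_of_length_ne_one]
    simpa [List.length_take, hk] using hk1

/-- The terms `k = 0` and `k = L.length + 1` of the recurrence `forestSeries_eq` contain the unknown
series itself, with the factor `2 * forestSeries []` that turns into `sqrtSeries`. -/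
theorem sqrtSeries_mul_forestSeries_cons (S : PlaneTree) (L : List PlaneTree) :
    sqrtSeries * forestSeries (S :: L) = forestSeries S.branches * forestSeries L +
      ∑ k ∈ Finset.range L.length, forestSeries (S :: L.take k) * forestSeries (L.drop k) := by
  have hsplit : forestSeries (S :: L) = ∑ k ∈ Finset.range (L.length + 2),
      (forestSeries ((S :: L).take k) + if k = 1 then forestSeries S.branches else 0) *
        forestSeries ((S :: L).drop k) := by
    conv_lhs => rw [forestSeries_eq, if_neg (List.cons_ne_nil S L), zero_add, List.length_cons]
    refine Finset.sum_congr rfl fun k hk => ?_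
    rw [treeSeries_take_cons S (Nat.lt_succ_iff.1 (Finset.mem_range.1 hk))]
  have hroot : ∑ k ∈ Finset.range (L.length + 2),
      (if k = 1 then forestSeries S.branches else 0) * forestSeries ((S :: L).drop k) =
        forestSeries S.branches * forestSeries L := by
    simp [ite_mul]
  have hends : ∑ k ∈ Finset.range (L.length + 2),
      forestSeries ((S :: L).take k) * forestSeries ((S :: L).drop k) =
        ∑ k ∈ Finset.range L.length, forestSeries (S :: L.take k) * forestSeries (L.drop k) +
          forestSeries (S :: L) * forestSeries [] + forestSeries [] * forestSeries (S :: L) := by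
    rw [Finset.sum_range_succ', Finset.sum_range_succ]
    simp
  simp only [add_mul, Finset.sum_add_distrib] at hsplit
  rw [hroot, hends] at hsplit
  rw [sqrtSeries]
  linear_combination hsplit

end GeneratingFunctions

section LeadingTerm

open PowerSeries

/-- `F` is `c * w⁻¹ ^ j` plus lower powers of `w⁻¹` and finitely many powers of `w`, where `w` is
`sqrtSeries`: thus `F` has a pole of order at most `j` at `w = 0`, with leading coefficient `c`. -/
def HasLeadingTerm (F : ℝ⟦X⟧) (c : ℝ) (j : ℕ) : Prop :=
  ∃ p : Polynomial ℝ, p.coeff 0 = c ∧ F = sqrtSeries⁻¹ ^ j * Polynomial.aeval sqrtSeries p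

variable {F G : ℝ⟦X⟧} {c d : ℝ} {i j : ℕ}

theorem HasLeadingTerm.mul (hF : HasLeadingTerm F c i) (hG : HasLeadingTerm G d j) :
    HasLeadingTerm (F * G) (c * d) (i + j) := by
  obtain ⟨p, rfl, rfl⟩ := hF
  obtain ⟨q, rfl, rfl⟩ := hG
  exact ⟨p * q, Polynomial.mul_coeff_zero p q, by rw [map_mul]; ring⟩

theorem HasLeadingTerm.add (hF : HasLeadingTerm F c j) (hG : HasLeadingTerm G d j) :
    HasLeadingTerm (F + G) (c + d) j := by
  obtain ⟨p, rfl, rfl⟩ := hF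
  obtain ⟨q, rfl, rfl⟩ := hG
  exact ⟨p + q, Polynomial.coeff_add p q 0, by rw [map_add]; ring⟩

theorem HasLeadingTerm.sum {ι : Type*} {s : Finset ι} {F : ι → ℝ⟦X⟧} {c : ι → ℝ}
    (h : ∀ k ∈ s, HasLeadingTerm (F k) (c k) j) :
    HasLeadingTerm (∑ k ∈ s, F k) (∑ k ∈ s, c k) j := by
  classical
  induction s using Finset.induction_on with
  | empty => exact ⟨0, by simp, by simp⟩
  | insert k s hk ih =>
    rw [Finset.sum_insert hk, Finset.sum_insert hk]
    exact (h k (Finset.mem_insert_self k s)).add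
      (ih fun l hl => h l (Finset.mem_insert_of_mem hl))

theorem HasLeadingTerm.succ (hF : HasLeadingTerm F c j) : HasLeadingTerm F 0 (j + 1) := by
  obtain ⟨p, rfl, rfl⟩ := hF
  refine ⟨Polynomial.X * p, Polynomial.coeff_X_mul_zero p, ?_⟩
  rw [map_mul, Polynomial.aeval_X]
  linear_combination (-sqrtSeries⁻¹ ^ j * Polynomial.aeval sqrtSeries p) * sqrtSeries_mul_inv

theorem HasLeadingTerm.of_sqrtSeries_mul (hF : HasLeadingTerm (sqrtSeries * F) c j) :
    HasLeadingTerm F c (j + 1) := by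
  obtain ⟨p, rfl, hp⟩ := hF
  exact ⟨p, rfl, by linear_combination sqrtSeries⁻¹ * hp - F * sqrtSeries_mul_inv⟩

theorem hasLeadingTerm_forestSeries_nil : HasLeadingTerm (forestSeries []) (1 / 2) 0 := by
  refine ⟨Polynomial.C (1 / 2) * (1 - Polynomial.X), by simp, ?_⟩
  have htwo : PowerSeries.C (1 / 2 : ℝ) * 2 = 1 := by
    rw [← map_ofNat (PowerSeries.C (R := ℝ)) 2, ← map_mul]
    norm_num
  rw [pow_zero, one_mul, map_mul, Polynomial.aeval_C, map_sub, map_one, Polynomial.aeval_X,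
    sqrtSeries]
  change _ = PowerSeries.C (1 / 2 : ℝ) * _
  linear_combination (-forestSeries []) * htwo

theorem exists_hasLeadingTerm_sum_split {T : PlaneTree} {L : List PlaneTree} (hL : L ≠ [])
    (hsmaller : ∀ M, forestWeight M < forestWeight (T :: L) →
      ∃ c > 0, HasLeadingTerm (forestSeries M) c (forestWeight M - 1)) :
    ∃ c > 0, HasLeadingTerm
      (∑ k ∈ Finset.range L.length, forestSeries (T :: L.take k) * forestSeries (L.drop k)) c
      (singOrder T + forestWeight L) := by
  have hterm : ∀ k ∈ Finset.range L.length, ∃ c > 0,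
      HasLeadingTerm (forestSeries (T :: L.take k) * forestSeries (L.drop k)) c
        (singOrder T + forestWeight L) := by
    intro k hk
    have hdrop : 2 ≤ forestWeight (L.drop k) :=
      two_le_forestWeight (by simpa using Finset.mem_range.1 hk)
    have hsplit : forestWeight L = forestWeight (L.take k) + forestWeight (L.drop k) := by
      rw [← forestWeight_append, List.take_append_drop]
    obtain ⟨a, ha, htake⟩ := hsmaller (T :: L.take k) (by rw [forestWeight, forestWeight]; omega)
    obtain ⟨b, hb, hdrop'⟩ := hsmaller (L.drop k) (by rw [forestWeight]; omega)
    refine ⟨a * b, mul_pos ha hb, ?_⟩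
    convert htake.mul hdrop' using 1
    rw [forestWeight]
    omega
  choose! c hc hterm using hterm
  exact ⟨∑ k ∈ Finset.range L.length, c k,
    Finset.sum_pos hc (Finset.nonempty_range_iff.2 (by simpa using hL)), HasLeadingTerm.sum hterm⟩

/-- In the recurrence for `L ≠ []` the terms of maximal order are those of the sum, while for
`L = []` the sum is empty and the first term is the leading one. -/
theorem exists_hasLeadingTerm_forestSeries_cons {T : PlaneTree} {L : List PlaneTree}
    (hsmaller : ∀ M, forestWeight M < forestWeight (T :: L) →
      ∃ c > 0, HasLeadingTerm (forestSeries M) c (forestWeight M - 1)) :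
    ∃ c > 0, HasLeadingTerm (forestSeries (T :: L)) c (forestWeight (T :: L) - 1) := by
  obtain ⟨ss⟩ := T
  obtain ⟨a, ha, hss⟩ := hsmaller ss (by rw [forestWeight, singOrder]; omega)
  obtain ⟨b, hb, hforest⟩ := hsmaller L (by rw [forestWeight]; omega)
  rw [← singOrder] at hss
  have hweight : forestWeight (node ss :: L) - 1 = singOrder (node ss) + forestWeight L + 1 := by
    rw [forestWeight]
    omega
  rw [hweight]
  suffices h : ∃ c > 0, HasLeadingTerm (sqrtSeries * forestSeries (node ss :: L)) c
      (singOrder (node ss) + forestWeight L) from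
    h.imp fun c hc => ⟨hc.1, hc.2.of_sqrtSeries_mul⟩
  rw [sqrtSeries_mul_forestSeries_cons, branches]
  rcases eq_or_ne L [] with rfl | hL
  · rw [List.length_nil, Finset.sum_range_zero, add_zero]
    exact ⟨a * b, mul_pos ha hb, by simpa [forestWeight] using hss.mul hforest⟩
  · obtain ⟨c, hc, hsum⟩ := exists_hasLeadingTerm_sum_split hL hsmaller
    have hroot : HasLeadingTerm (forestSeries ss * forestSeries L) 0
        (singOrder (node ss) + forestWeight L) := by
      have := two_le_forestWeight hL
      convert (hss.mul hforest).succ using 1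
      omega
    exact ⟨0 + c, by rwa [zero_add], hroot.add hsum⟩

theorem exists_hasLeadingTerm_forestSeries (L : List PlaneTree) :
    ∃ c > 0, HasLeadingTerm (forestSeries L) c (forestWeight L - 1) := by
  induction hw : forestWeight L using Nat.strong_induction_on generalizing L with
  | _ w ih =>
  subst hw
  rcases L with _ | ⟨T, L⟩
  · exact ⟨1 / 2, by norm_num, by simpa [forestWeight] using hasLeadingTerm_forestSeries_nil⟩
  · exact exists_hasLeadingTerm_forestSeries_cons fun M hM => ih (forestWeight M) hM M rfl

theorem exists_hasLeadingTerm_good_all (S : PlaneTree) :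
    ∃ c > 0, HasLeadingTerm (forestSeries S.branches) c (singOrder S) ∧
      HasLeadingTerm (treeSeries [S]) (c / 2) (singOrder S + 1) := by
  obtain ⟨ss⟩ := S
  obtain ⟨c, hc, hgood⟩ := exists_hasLeadingTerm_forestSeries ss
  rw [← singOrder] at hgood
  have hsingle :
      HasLeadingTerm (forestSeries [node ss]) (c * (1 / 2)) (singOrder (node ss) + 1) := by
    refine HasLeadingTerm.of_sqrtSeries_mul ?_
    rw [sqrtSeries_mul_forestSeries_cons, List.length_nil, Finset.sum_range_zero, add_zero]
    exact hgood.mul hasLeadingTerm_forestSeries_nil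
  refine ⟨c, hc, hgood, ?_⟩
  rw [treeSeries_singleton, branches, show c / 2 = c * (1 / 2) + 0 by ring]
  exact hsingle.add hgood.succ

end LeadingTerm

section Asymptotics

open PowerSeries Filter Topology

theorem sqrtSeries_eq_oneSubRpow : sqrtSeries = oneSubRpow 4 (1 / 2) := by
  have hsq : oneSubRpow 4 (1 / 2) * oneSubRpow 4 (1 / 2) = 1 - 4 * X := by
    rw [← oneSubRpow_add, add_halves, oneSubRpow_one, map_ofNat]
  have hprod : (sqrtSeries - oneSubRpow 4 (1 / 2)) * (sqrtSeries + oneSubRpow 4 (1 / 2)) = 0 := by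
    linear_combination sqrtSeries_mul_self - hsq
  refine sub_eq_zero.1 ((mul_eq_zero.1 hprod).resolve_right fun h => ?_)
  have hconst := congrArg constantCoeff h
  rw [map_add, constantCoeff_sqrtSeries, constantCoeff_oneSubRpow, map_zero] at hconst
  norm_num at hconst

theorem inv_sqrtSeries_eq_oneSubRpow : sqrtSeries⁻¹ = oneSubRpow 4 (-(1 / 2)) := by
  refine (PowerSeries.inv_eq_iff_mul_eq_one (by simp [constantCoeff_sqrtSeries])).2 ?_
  rw [sqrtSeries_eq_oneSubRpow, ← oneSubRpow_add, neg_add_cancel, oneSubRpow_zero]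

theorem inv_sqrtSeries_pow_mul_sqrtSeries_pow (j i : ℕ) :
    sqrtSeries⁻¹ ^ j * sqrtSeries ^ i = oneSubRpow 4 (-((j - i) / 2)) := by
  rw [inv_sqrtSeries_eq_oneSubRpow, sqrtSeries_eq_oneSubRpow, oneSubRpow_pow, oneSubRpow_pow,
    ← oneSubRpow_add]
  congr 1
  ring

theorem HasLeadingTerm.tendsto_coeff {F : ℝ⟦X⟧} {c : ℝ} {j : ℕ} (hF : HasLeadingTerm F c j) :
    Tendsto (fun n : ℕ => coeff n F / (4 ^ n * (n : ℝ) ^ ((j : ℝ) / 2 - 1))) atTop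
      (𝓝 (c * (Real.Gamma (j / 2))⁻¹)) := by
  obtain ⟨p, rfl, rfl⟩ := hF
  have hcoeff (n : ℕ) : coeff n (sqrtSeries⁻¹ ^ j * Polynomial.aeval sqrtSeries p) =
      ∑ i ∈ Finset.range (p.natDegree + 1),
        p.coeff i * coeff n (oneSubRpow 4 (-(((j : ℝ) - i) / 2))) := by
    simp only [Polynomial.aeval_eq_sum_range, Finset.mul_sum, map_sum, mul_smul_comm,
      coeff_smul, smul_eq_mul, inv_sqrtSeries_pow_mul_sqrtSeries_pow]
  have hterm (i : ℕ) : Tendsto (fun n : ℕ => coeff n (oneSubRpow 4 (-(((j : ℝ) - i) / 2))) /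
      (4 ^ n * (n : ℝ) ^ ((j : ℝ) / 2 - 1))) atTop
        (𝓝 (if i = 0 then (Real.Gamma (j / 2))⁻¹ else 0)) := by
    split_ifs with hi
    · simpa [hi] using tendsto_coeff_oneSubRpow_neg_div (a := 4) (by norm_num) ((j : ℝ) / 2)
    · refine tendsto_coeff_oneSubRpow_neg_div_of_lt (by norm_num) ?_
      have : (0 : ℝ) < i := Nat.cast_pos.2 (Nat.pos_of_ne_zero hi)
      linarith
  have hlim := tendsto_finsetSum (Finset.range (p.natDegree + 1)) fun i _ =>
    (hterm i).const_mul (p.coeff i)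
  simpa [hcoeff, Finset.sum_div, mul_div_assoc] using hlim

theorem eventually_allTotal_pos (S : PlaneTree) : ∀ᶠ n in atTop, 0 < allTotal n S := by
  obtain ⟨c, hc, -, hall⟩ := exists_hasLeadingTerm_good_all S
  have hlimit : 0 < c / 2 * (Real.Gamma ((singOrder S + 1 : ℕ) / 2))⁻¹ :=
    mul_pos (half_pos hc) (inv_pos.2 (Real.Gamma_pos_of_pos (by positivity)))
  filter_upwards [hall.tendsto_coeff.eventually_const_lt hlimit] with n hn
  refine Nat.pos_of_ne_zero fun h => hn.ne ?_
  rw [coeff_treeSeries_singleton, h, Nat.cast_zero, zero_div]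

theorem tendsto_sqrt_mul_goodTotal_div_allTotal (S : PlaneTree) :
    Tendsto (fun n : ℕ => √(n : ℝ) * ((goodTotal n S : ℝ) / allTotal n S)) atTop
      (𝓝 (2 * (Real.Gamma (singOrder S / 2 + 1 / 2) / Real.Gamma (singOrder S / 2)))) := by
  obtain ⟨c, hc, hgood, hall⟩ := exists_hasLeadingTerm_good_all S
  have hΓ : Real.Gamma ((singOrder S + 1 : ℕ) / 2) ≠ 0 :=
    (Real.Gamma_pos_of_pos (by positivity)).ne'
  have hlim := hgood.tendsto_coeff.div hall.tendsto_coeff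
    (mul_ne_zero (half_pos hc).ne' (inv_ne_zero hΓ))
  simp only [coeff_forestSeries_branches, coeff_treeSeries_singleton] at hlim
  rw [Nat.cast_succ, add_div] at hlim hΓ
  convert hlim.congr' ?_ using 2
  · field_simp
  · filter_upwards [eventually_gt_atTop 0] with n hn
    have hn' : (0 : ℝ) < n := Nat.cast_pos.2 hn
    have hpow : (n : ℝ) ^ ((singOrder S : ℝ) / 2 + 1 / 2 - 1) =
        (n : ℝ) ^ ((singOrder S : ℝ) / 2 - 1) * √(n : ℝ) := by
      rw [add_sub_right_comm, Real.rpow_add hn', Real.sqrt_eq_rpow]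
    simp only [Pi.div_apply]
    rw [hpow]
    field_simp

end Asymptotics

end PlaneTree

theorem mainTheorem12 (S₁ S₂ : PlaneTree) (h : PlaneTree.EmbedsInto S₁ S₂) :
    ∀ᶠ n : ℕ in Filter.atTop,
      0 < PlaneTree.allTotal n S₁ ∧ 0 < PlaneTree.allTotal n S₂ ∧
        (PlaneTree.goodTotal n S₁ : ℝ) / (PlaneTree.allTotal n S₁ : ℝ) ≤
          (PlaneTree.goodTotal n S₂ : ℝ) / (PlaneTree.allTotal n S₂ : ℝ) := by
  rcases eq_or_ne S₁ S₂ with rfl | hne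
  · exact (PlaneTree.eventually_allTotal_pos S₁).mono fun n hn => ⟨hn, hn, le_rfl⟩
  have horder : (PlaneTree.singOrder S₁ : ℝ) / 2 < PlaneTree.singOrder S₂ / 2 := by
    have := h.singOrder_lt hne
    gcongr
  have hlimit := mul_lt_mul_of_pos_left (strictMonoOn_gamma_add_div_gamma one_half_pos
    (Set.mem_Ici.2 (by positivity)) (Set.mem_Ici.2 (by positivity)) horder) (zero_lt_two' ℝ)
  filter_upwards [PlaneTree.eventually_allTotal_pos S₁, PlaneTree.eventually_allTotal_pos S₂,
    (PlaneTree.tendsto_sqrt_mul_goodTotal_div_allTotal S₁).eventually_lt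
      (PlaneTree.tendsto_sqrt_mul_goodTotal_div_allTotal S₂) hlimit] with n hpos₁ hpos₂ hlt
  exact ⟨hpos₁, hpos₂, (lt_of_mul_lt_mul_left hlt (Real.sqrt_nonneg n)).le⟩
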